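/- Let $\mathcal E$ be a complex Hilbert space of dimension at least $2$, finite or countably infinite. For every $\tau>0$ let $\mathcal H_\tau(s)$, $0\le s\le 1$, be self-adjoint operators on $\mathcal E$ (bounded or unbounded) whose domain $D_\tau$ does not depend on $s$, and suppose that $s\mapsto \mathcal H_\tau(s)$ is twice differentiable on $[0,1]$, with derivatives $\dot{\mathcal H}_\tau(s),\ddot{\mathcal H}_\tau(s)$ with respect to $s$ that are bounded operators; that is, $\frac{d}{ds}\mathcal H_\tau(s)x=\dot{\mathcal H}_\tau(s)x$ for $x\in D_\tau$, and $\ddot{\mathcal H}_\tau$ is the derivative of $\dot{\mathcal H}_\tau$ in operator norm. Suppose that each $\mathcal H_\tau(s)$ has a complete orthonormal system of eigenstates $\psi_{\tau,0}(s),\psi_{\tau,1}(s),\dots$ (finite or infinite) with eigenvalues $\lambda_{\tau,0}(s)\le\lambda_{\tau,1}(s)\le\cdots$, repeated according to multiplicity. Let $P_\tau(s)$ be the orthogonal projection onto the line spanned by the ground state $\psi_{\tau,0}(s)$, let $Q_\tau(s)=I-P_\tau(s)$, and let $\gamma_\tau(s)=\lambda_{\tau,1}(s)-\lambda_{\tau,0}(s)$.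 Let $U_\tau(s)$ be the evolution operator, that is, the solution of $$\dot U_\tau(s)=-i\tau\,\mathcal H_\tau(s)U_\tau(s),\qquad U_\tau(0)=I$$ for fixed $\tau$ (in the unbounded case: $U_\tau(s)D_\tau\subseteq D_\tau$, and the equation holds when applied to each $x\in D_\tau$). Assume that there are real functions $g_1,g_2$ of $\tau$ with $$\|\dot{\mathcal H}_\tau(s)\|\le g_1(\tau),\qquad \|\ddot{\mathcal H}_\tau(s)\|\le g_2(\tau)\qquad\text{for all } s\in[0,1],\ \tau>0,$$ and a constant $\bar\gamma_{\min}$ with $0<\bar\gamma_{\min}\le\gamma_\tau(s)$ for all $s\in[0,1]$ and $\tau>0$. Then for all $\tau>0$ and $s\in[0,1]$, in operator norm, $$\|Q_\tau(s)U_\tau(s)P_\tau(0)\|\le\frac{8}{\tau\bar\gamma_{\min}^2}\left(2g_1(\tau)+s\,g_2(\tau)+s\,\frac{16\,g_1(\tau)^2}{\bar\gamma_{\min}}\right).$$ -/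

import Mathlib

/-- The index set of the energy levels: `{0, …, N - 1}` when the Hilbert space has finite
dimension `N`, and `{0, 1, 2, …}` when `N = ⊤`. -/
abbrev LevelIndex (N : ℕ∞) : Type := {j : ℕ // (j : ℕ∞) < N}

/-- The index of the ground state. -/
def groundIndex {N : ℕ∞} (hN : 2 ≤ N) : LevelIndex N :=
  ⟨0, lt_of_lt_of_le (by norm_num) hN⟩

/-- The index of the first excited state. -/
def excitedIndex {N : ℕ∞} (hN : 2 ≤ N) : LevelIndex N :=
  ⟨1, lt_of_lt_of_le (by norm_num) hN⟩

section

variable {E : Type*} [NormedAddCommGroup E] [InnerProductSpace ℂ E]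

/-- The (possibly unbounded) operator `H` with domain `D` is self-adjoint; for `D = ⊤` in finite
dimension this says that `H` is Hermitian. -/
def IsHamiltonian [CompleteSpace E] {D : Submodule ℂ E} (H : D →ₗ[ℂ] E) : Prop :=
  IsSelfAdjoint (LinearPMap.mk D H)

/-- On `[0, 1]` the operator-valued function `H`, with a domain `D` that does not depend on the
parameter, is twice differentiable, its first and second derivatives being the bounded
operators `H'` and `H''`. (At `0` and `1` the derivatives are one-sided.) -/
structure IsTwiceDifferentiable {D : Submodule ℂ E} (H : ℝ → D →ₗ[ℂ] E)
    (H' H'' : ℝ → E →L[ℂ] E) : Prop where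
  hasDeriv : ∀ s ∈ Set.Icc (0 : ℝ) 1, ∀ x : D,
    HasDerivWithinAt (fun r => H r x) (H' s x) (Set.Icc 0 1) s
  hasDeriv₂ : ∀ s ∈ Set.Icc (0 : ℝ) 1, HasDerivWithinAt H' (H'' s) (Set.Icc 0 1) s

/-- `ψ` is a complete orthonormal system of eigenstates of `H`, the eigenvalue of `ψ j` being
`ev j`, and the eigenvalues (repeated according to multiplicity) are listed in increasing order. -/
structure IsOrderedEigenbasis {N : ℕ∞} {D : Submodule ℂ E} (H : D →ₗ[ℂ] E)
    (ψ : HilbertBasis (LevelIndex N) ℂ E) (ev : LevelIndex N → ℝ) : Prop where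
  mem_domain : ∀ j, ψ j ∈ D
  eigen : ∀ j, H ⟨ψ j, mem_domain j⟩ = (ev j : ℂ) • ψ j
  monotone : Monotone ev

/-- The energy difference between the ground state and the first excited state. -/
def energyGap {N : ℕ∞} (hN : 2 ≤ N) (ev : LevelIndex N → ℝ) : ℝ :=
  ev (excitedIndex hN) - ev (groundIndex hN)

/-- The orthogonal projection onto the line spanned by the ground state. -/
noncomputable def groundProj {N : ℕ∞} (hN : 2 ≤ N) (ψ : HilbertBasis (LevelIndex N) ℂ E) :
    E →L[ℂ] E :=
  (Submodule.span ℂ {ψ (groundIndex hN)}).starProjection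

/-- `U` is the evolution operator of `H` on `[0, 1]`: the solution of
`dU/ds = -i τ H(s) U(s)`, `U(0) = 1`, on the domain of the Hamiltonian. -/
structure IsEvolution (τ : ℝ) {D : Submodule ℂ E} (H : ℝ → D →ₗ[ℂ] E)
    (U : ℝ → E →L[ℂ] E) : Prop where
  initial : U 0 = 1
  mem_domain : ∀ s ∈ Set.Icc (0 : ℝ) 1, ∀ x ∈ D, U s x ∈ D
  schrodinger : ∀ (s : ℝ) (hs : s ∈ Set.Icc (0 : ℝ) 1) (x : E) (hx : x ∈ D),
    HasDerivWithinAt (fun r => U r x)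
      ((-Complex.I * (τ : ℂ)) • H s ⟨U s x, mem_domain s hs x hx⟩) (Set.Icc 0 1) s

end

open scoped InnerProductSpace
open Filter Topology

/-! Write `u` for the evolved ground state, `P` for the ground projection, `l` for the ground energy
and `R` for the reduced resolvent, the inverse of `H - l` off the ground line and zero on it. The
gap gives `‖R‖ ≤ γ⁻¹`. Since `‖u‖ = 1`, the excited population is `‖u - P u‖² = 1 - ⟪u, P u⟫`. The
dynamics contributes nothing to the derivative of `⟪u, P u⟫`, because `P (H - l) = 0`; what remains
is `⟪u, P' u⟫`, where `P' = -(B + B*)` and `B = R H' P`. This term is not small, but it oscillates.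
The operator `A = R² H' P` satisfies `(H - l) A = B` and `A (H - l) = 0`, so the derivative of `⟪u,
A u⟫` is `i τ ⟪u, B u⟫ + ⟪u, A' u⟫`. Subtracting `(2 / τ) Im ⟪u, A u⟫` therefore cancels it and
leaves a rate of order `1 / τ`. Moreover `P A' = B* R B` has real expectation, so only the excited
part of `u` pairs with `A' u`. The rate thus carries a factor `‖u - P u‖`
(`exists_corrected_population_deriv`), as does the corrector itself. At a maximum `M` of the excited
amplitude on `[0, s]` this gives `M² ≤ const · M / τ`, and dividing by `M` gives the bound
(`norm_excited_le`). Differentiability of `l`, `P` and `R` comes from exact identities comparing two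
parameter values. Only projections are compared, so no phase of the eigenvectors is ever chosen. -/

/-! ### Spectral data of a single Hamiltonian. -/

/-- The bounded operator that is diagonal in a Hilbert basis, with a bounded family of
diagonal entries. -/
theorem HilbertBasis.exists_diagonal {ι E : Type*} [NormedAddCommGroup E] [InnerProductSpace ℂ E]
    (b : HilbertBasis ι ℂ E) (c : ι → ℝ) {C : ℝ} (hC : 0 ≤ C) (hc : ∀ i, |c i| ≤ C) :
    ∃ R : E →L[ℂ] E, ‖R‖ ≤ C ∧ ∀ x i, ⟪b i, R x⟫_ℂ = c i * ⟪b i, x⟫_ℂ := by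
  have hT : ∀ i, ‖((c i : ℂ) • (1 : ℂ →L[ℂ] ℂ))‖ ≤ C := fun i => by
    rw [norm_smul, norm_one, mul_one, Complex.norm_real]; exact hc i
  set T := lp.mapCLM 2 (fun i : ι => (c i : ℂ) • (1 : ℂ →L[ℂ] ℂ)) hC hT with hTdef
  refine ⟨(b.repr.symm.toContinuousLinearEquiv : lp (fun _ : ι => ℂ) 2 →L[ℂ] E) ∘L T ∘L
    (b.repr.toContinuousLinearEquiv : E →L[ℂ] lp (fun _ : ι => ℂ) 2), ?_, ?_⟩
  · refine ContinuousLinearMap.opNorm_le_bound _ hC fun x => ?_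
    simp only [ContinuousLinearMap.comp_apply, ContinuousLinearEquiv.coe_coe,
      LinearIsometryEquiv.coe_toContinuousLinearEquiv, LinearIsometryEquiv.norm_map]
    refine (T.le_opNorm _).trans ?_
    rw [LinearIsometryEquiv.norm_map]
    exact mul_le_mul_of_nonneg_right (lp.norm_mapCLM_le 2 _ hC hT) (norm_nonneg _)
  · intro x i
    rw [← b.repr_apply_apply, ← b.repr_apply_apply]
    simp [hTdef, lp.mapCLM]

theorem HilbertBasis.ext_inner {ι E : Type*} [NormedAddCommGroup E] [InnerProductSpace ℂ E]
    (b : HilbertBasis ι ℂ E) {x y : E} (h : ∀ i, ⟪b i, x⟫_ℂ = ⟪b i, y⟫_ℂ) : x = y := by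
  apply b.repr.injective
  ext i
  rw [b.repr_apply_apply, b.repr_apply_apply, h i]

/-- `l` is the ground energy of the symmetric operator `H`, isolated from the rest of the spectrum
by at least `γ`, with unit eigenvector `φ`, ground projection `P` and reduced resolvent `R`. -/
structure IsGappedGroundState {E : Type*} [NormedAddCommGroup E] [InnerProductSpace ℂ E]
    {D : Submodule ℂ E} (H : D →ₗ[ℂ] E) (l γ : ℝ) (φ : E) (P R : E →L[ℂ] E) : Prop where
  norm_state : ‖φ‖ = 1
  proj_apply : ∀ x, P x = ⟪φ, x⟫_ℂ • φ
  state_mem : φ ∈ D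
  eigen : H ⟨φ, state_mem⟩ = (l : ℂ) • φ
  resolvent_mem : ∀ x, R x ∈ D
  sub_resolvent : ∀ x, H ⟨R x, resolvent_mem x⟩ - (l : ℂ) • R x = x - P x
  resolvent_sub : ∀ x : D, R (H x - (l : ℂ) • (x : E)) = x - P x
  resolvent_state : R φ = 0
  resolvent_symm : ∀ x y, ⟪R x, y⟫_ℂ = ⟪x, R y⟫_ℂ
  norm_resolvent : ‖R‖ ≤ γ⁻¹
  symm : ∀ x y : D, ⟪H x, y⟫_ℂ = ⟪(x : E), H y⟫_ℂ
  nonneg : ∀ x : D, l * ‖(x : E)‖ ^ 2 ≤ (⟪(x : E), H x⟫_ℂ).re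

theorem IsHamiltonian.symmetric {E : Type*} [NormedAddCommGroup E] [InnerProductSpace ℂ E]
    [CompleteSpace E] {D : Submodule ℂ E} {H : D →ₗ[ℂ] E} (hH : IsHamiltonian H) (x y : D) :
    ⟪H x, y⟫_ℂ = ⟪(x : E), H y⟫_ℂ := by
  have h1 : LinearPMap.adjoint (LinearPMap.mk D H) = LinearPMap.mk D H := hH
  have h2 := LinearPMap.adjoint_isFormalAdjoint hH.dense_domain
  rw [h1] at h2
  exact h2 x y

/-- The domain of a self-adjoint operator is that of its adjoint, so membership can be tested
weakly. This is what places the range of the reduced resolvent in `D`. -/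
theorem IsHamiltonian.exists_mem_of_inner {E : Type*} [NormedAddCommGroup E]
    [InnerProductSpace ℂ E] [CompleteSpace E] {D : Submodule ℂ E} {H : D →ₗ[ℂ] E}
    (hH : IsHamiltonian H) {y w : E} (h : ∀ x : D, ⟪w, x⟫_ℂ = ⟪y, H x⟫_ℂ) :
    ∃ hy : y ∈ D, H ⟨y, hy⟩ = w := by
  have h1 : LinearPMap.adjoint (LinearPMap.mk D H) = LinearPMap.mk D H := hH
  have h2 : y ∈ (LinearPMap.adjoint (LinearPMap.mk D H)).domain :=
    LinearPMap.mem_adjoint_domain_of_exists y ⟨w, h⟩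
  have h3 := LinearPMap.adjoint_apply_eq hH.dense_domain ⟨y, h2⟩ h
  have h4 : ∀ T : E →ₗ.[ℂ] E, T = LinearPMap.mk D H → ∀ hT : y ∈ T.domain, T ⟨y, hT⟩ = w →
      ∃ hy : y ∈ D, H ⟨y, hy⟩ = w := by
    rintro _ rfl hT h; exact ⟨hT, h⟩
  exact h4 _ h1 h2 h3

theorem IsOrderedEigenbasis.exists_gappedGroundState {E : Type*} [NormedAddCommGroup E]
    [InnerProductSpace ℂ E] [CompleteSpace E] {N : ℕ∞} (hN : 2 ≤ N) {D : Submodule ℂ E}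
    {H : D →ₗ[ℂ] E} {ψ : HilbertBasis (LevelIndex N) ℂ E} {ev : LevelIndex N → ℝ}
    (hH : IsHamiltonian H) (h : IsOrderedEigenbasis H ψ ev) {γ : ℝ} (hγ0 : 0 < γ)
    (hγ : γ ≤ energyGap hN ev) :
    ∃ R : E →L[ℂ] E, IsGappedGroundState H (ev (groundIndex hN)) γ (ψ (groundIndex hN))
      (groundProj hN ψ) R := by
  set l := ev (groundIndex hN) with hl
  set φ := ψ (groundIndex hN) with hφ
  have hφn : ‖φ‖ = 1 := ψ.orthonormal.1 _
  have hP : ∀ x, groundProj hN ψ x = ⟪φ, x⟫_ℂ • φ := fun x => by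
    rw [groundProj, Submodule.starProjection_unit_singleton ℂ hφn]
  have hgap : ∀ i, i ≠ groundIndex hN → γ ≤ ev i - l := by
    intro i hi
    have h1 : excitedIndex hN ≤ i := by
      have : i.1 ≠ 0 := fun h0 => hi (Subtype.ext h0)
      exact Subtype.mk_le_mk.2 (Nat.one_le_iff_ne_zero.2 this)
    have := h.monotone h1
    have h2 : γ ≤ ev (excitedIndex hN) - l := hγ
    linarith
  have hmin : ∀ i, l ≤ ev i := fun i => h.monotone (Subtype.mk_le_mk.2 (Nat.zero_le _))
  have hcoord : ∀ (x : D) i, ⟪ψ i, H x⟫_ℂ = ev i * ⟪ψ i, (x : E)⟫_ℂ := by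
    intro x i
    have h1 := hH.symmetric ⟨ψ i, h.mem_domain i⟩ x
    rw [h.eigen i, inner_smul_left] at h1
    simpa using h1.symm
  have hsingle : ∀ i, i ≠ groundIndex hN → ⟪ψ i, φ⟫_ℂ = 0 := fun i hi => ψ.orthonormal.2 hi
  have hself : ⟪φ, φ⟫_ℂ = 1 := by rw [inner_self_eq_norm_sq_to_K, hφn]; simp
  have hinv : ∀ i, |(ev i - l)⁻¹| ≤ γ⁻¹ := by
    intro i
    by_cases hi : i = groundIndex hN
    · rw [hi, ← hl]; simp [hγ0.le]
    · have := hgap i hi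
      rw [abs_inv, abs_of_nonneg (by linarith)]
      exact inv_anti₀ hγ0 this
  -- The convention `0⁻¹ = 0` makes `R` vanish on the ground state, as a reduced resolvent should.
  obtain ⟨R, hRn, hR⟩ := ψ.exists_diagonal (fun i => (ev i - l)⁻¹) (inv_nonneg.2 hγ0.le) hinv
  have hQ : ∀ x i, ((ev i : ℂ) - l) * ⟪ψ i, R x⟫_ℂ = ⟪ψ i, x - groundProj hN ψ x⟫_ℂ := by
    intro x i
    rw [hR, inner_sub_right, hP, inner_smul_right]
    by_cases hi : i = groundIndex hN
    · rw [hi, ← hl, ← hφ, hself]; simp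
    · have h0 : ((ev i : ℂ) - l) ≠ 0 := by
        have := hgap i hi
        have h3 : ev i - l ≠ 0 := by linarith
        exact_mod_cast h3
      rw [hsingle i hi]; push_cast; field_simp; simp
  have hRs : ∀ x y, ⟪R x, y⟫_ℂ = ⟪x, R y⟫_ℂ := by
    intro x y
    rw [← ψ.tsum_inner_mul_inner, ← ψ.tsum_inner_mul_inner x]
    refine tsum_congr fun i => ?_
    rw [← inner_conj_symm, hR, hR, map_mul, Complex.conj_ofReal, inner_conj_symm]; ring
  have hmem : ∀ x, ∃ hx : R x ∈ D,
      H ⟨R x, hx⟩ = (l : ℂ) • R x + (x - groundProj hN ψ x) := by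
    intro x
    refine hH.exists_mem_of_inner fun z => ?_
    rw [← ψ.tsum_inner_mul_inner, ← ψ.tsum_inner_mul_inner (R x)]
    refine tsum_congr fun i => ?_
    rw [hcoord, inner_add_left, ← inner_conj_symm (x - _), ← hQ, inner_smul_left, map_mul,
      inner_conj_symm, map_sub, Complex.conj_ofReal, Complex.conj_ofReal]
    ring
  refine ⟨R, hφn, hP, h.mem_domain _, h.eigen _, fun x => (hmem x).1, fun x => ?_, fun x => ?_,
    ?_, hRs, hRn, hH.symmetric, fun x => ?_⟩
  · rw [(hmem x).2]; abel
  · refine ψ.ext_inner fun i => ?_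
    rw [hR, inner_sub_right, hcoord, inner_smul_right, ← hQ, hR]
    ring
  · refine ψ.ext_inner fun i => ?_
    rw [hR, inner_zero_right]
    by_cases hi : i = groundIndex hN
    · rw [hi, ← hl]; simp
    · rw [hsingle i hi, mul_zero]
  · have h1 := (ψ.hasSum_inner_mul_inner (x : E) (H x)).mapL Complex.reCLM
    have h2 := ((ψ.hasSum_inner_mul_inner (x : E) (x : E)).mapL Complex.reCLM).mul_left l
    simp only [Complex.reCLM_apply] at h1 h2
    have h3 : (⟪(x : E), (x : E)⟫_ℂ).re = ‖(x : E)‖ ^ 2 := inner_self_eq_norm_sq (𝕜 := ℂ) (x : E)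
    rw [← h3]
    refine hasSum_le (fun i => ?_) h2 h1
    have h4 : ⟪(x : E), ψ i⟫_ℂ * ⟪ψ i, (x : E)⟫_ℂ = ((‖⟪ψ i, (x : E)⟫_ℂ‖ ^ 2 : ℝ) : ℂ) := by
      rw [← inner_conj_symm (x : E)]
      rw [Complex.conj_mul']; push_cast; rfl
    rw [hcoord, mul_left_comm, h4, ← Complex.ofReal_mul, Complex.ofReal_re, Complex.ofReal_re]
    exact mul_le_mul_of_nonneg_right (hmin i) (sq_nonneg _)

/-! ### Exact comparison of two gapped ground states. -/

namespace IsGappedGroundState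

variable {E : Type*} [NormedAddCommGroup E] [InnerProductSpace ℂ E] {D : Submodule ℂ E}
  {H H₁ H₂ : D →ₗ[ℂ] E} {l l₁ l₂ γ γ₁ γ₂ : ℝ} {φ φ₁ φ₂ : E} {P P₁ P₂ R R₁ R₂ : E →L[ℂ] E}

theorem inner_state_self (h : IsGappedGroundState H l γ φ P R) : ⟪φ, φ⟫_ℂ = 1 := by
  rw [inner_self_eq_norm_sq_to_K, h.norm_state]; simp

theorem proj_state (h : IsGappedGroundState H l γ φ P R) : P φ = φ := by
  rw [h.proj_apply, h.inner_state_self, one_smul]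

theorem proj_proj (h : IsGappedGroundState H l γ φ P R) (x : E) : P (P x) = P x := by
  rw [h.proj_apply x, map_smul, h.proj_state]

theorem proj_symm (h : IsGappedGroundState H l γ φ P R) (x y : E) :
    ⟪P x, y⟫_ℂ = ⟪x, P y⟫_ℂ := by
  rw [h.proj_apply, h.proj_apply, inner_smul_left, inner_smul_right, inner_conj_symm, mul_comm]

theorem proj_mem (h : IsGappedGroundState H l γ φ P R) (x : E) : P x ∈ D := by
  rw [h.proj_apply]; exact D.smul_mem _ h.state_mem

theorem eigen_proj (h : IsGappedGroundState H l γ φ P R) (x : E) :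
    H ⟨P x, h.proj_mem x⟩ = (l : ℂ) • P x := by
  have : (⟨P x, h.proj_mem x⟩ : D) = ⟪φ, x⟫_ℂ • ⟨φ, h.state_mem⟩ :=
    Subtype.ext (h.proj_apply x)
  rw [this, map_smul, h.eigen, h.proj_apply, smul_comm]

theorem norm_proj_apply (h : IsGappedGroundState H l γ φ P R) (x : E) : ‖P x‖ ≤ ‖x‖ := by
  rw [h.proj_apply, norm_smul, h.norm_state, mul_one]
  simpa [h.norm_state] using norm_inner_le_norm (𝕜 := ℂ) φ x

theorem norm_proj (h : IsGappedGroundState H l γ φ P R) : ‖P‖ ≤ 1 :=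
  P.opNorm_le_bound zero_le_one fun x => by simpa using h.norm_proj_apply x

theorem norm_sub_proj_apply (h : IsGappedGroundState H l γ φ P R) (x : E) :
    ‖x - P x‖ ^ 2 = ‖x‖ ^ 2 - (⟪x, P x⟫_ℂ).re := by
  have h1 : ⟪x - P x, x - P x⟫_ℂ = ⟪x, x⟫_ℂ - ⟪x, P x⟫_ℂ := by
    rw [inner_sub_left, inner_sub_right, inner_sub_right, h.proj_symm x, h.proj_symm x,
      h.proj_proj]; ring
  have h2 := congrArg Complex.re h1
  rw [Complex.sub_re] at h2
  have h3 := inner_self_eq_norm_sq (𝕜 := ℂ) (x - P x)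
  have h4 := inner_self_eq_norm_sq (𝕜 := ℂ) x
  simp only [RCLike.re_to_complex] at h3 h4
  rw [← h3, ← h4, h2]

theorem resolvent_proj (h : IsGappedGroundState H l γ φ P R) : R * P = 0 := by
  ext x; simp [h.proj_apply, h.resolvent_state]

theorem proj_resolvent (h : IsGappedGroundState H l γ φ P R) : P * R = 0 := by
  ext x; simp [h.proj_apply, ← h.resolvent_symm, h.resolvent_state]

theorem proj_sub (h : IsGappedGroundState H l γ φ P R) (x : D) :
    P (H x - (l : ℂ) • (x : E)) = 0 := by
  have h1 := h.symm ⟨φ, h.state_mem⟩ x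
  rw [h.eigen, inner_smul_left] at h1
  rw [h.proj_apply, inner_sub_right, ← h1, inner_smul_right]
  simp

/-- Since `(H₂ - l₂) P₂ = 0`, one has `(H₁ - l₁) P₂ = -W P₂`; apply `R₁`. -/
theorem proj_sub_proj_mul (h₁ : IsGappedGroundState H₁ l₁ γ₁ φ₁ P₁ R₁)
    (h₂ : IsGappedGroundState H₂ l₂ γ₂ φ₂ P₂ R₂) {W : E →L[ℂ] E}
    (hW : ∀ x : D, H₂ x - H₁ x = (l₂ : ℂ) • (x : E) - (l₁ : ℂ) • (x : E) + W x) :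
    P₂ - P₁ * P₂ = -(R₁ * W * P₂) := by
  ext x
  have h3 := h₁.resolvent_sub ⟨P₂ x, h₂.proj_mem x⟩
  have h4 := hW ⟨P₂ x, h₂.proj_mem x⟩
  rw [h₂.eigen_proj] at h4
  have h5 : H₁ ⟨P₂ x, h₂.proj_mem x⟩ - (l₁ : ℂ) • P₂ x = - W (P₂ x) := by
    rw [← sub_eq_zero] at h4 ⊢
    rw [← neg_eq_zero, ← h4]; simp only; abel
  simp only at h3
  rw [h5, map_neg] at h3
  simpa using h3.symm

/-- Expand `1 - P₂ = (H₂ - l₂) R₂ = (H₁ - l₁) R₂ + W R₂` and apply `P₁`, which kills `H₁ - l₁`. -/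
theorem proj_sub_mul_proj (h₁ : IsGappedGroundState H₁ l₁ γ₁ φ₁ P₁ R₁)
    (h₂ : IsGappedGroundState H₂ l₂ γ₂ φ₂ P₂ R₂) {W : E →L[ℂ] E}
    (hW : ∀ x : D, H₂ x - H₁ x = (l₂ : ℂ) • (x : E) - (l₁ : ℂ) • (x : E) + W x) :
    P₁ - P₁ * P₂ = P₁ * W * R₂ := by
  ext x
  have h3 := h₁.proj_sub ⟨R₂ x, h₂.resolvent_mem x⟩
  have h4 := hW ⟨R₂ x, h₂.resolvent_mem x⟩
  have h5 := h₂.sub_resolvent x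
  have h6 : x - P₂ x = H₁ ⟨R₂ x, h₂.resolvent_mem x⟩ - (l₁ : ℂ) • R₂ x + W (R₂ x) := by
    rw [← h5, ← sub_eq_zero]
    rw [← sub_eq_zero] at h4
    rw [← h4]; simp only; abel
  have h7 := congrArg P₁ h6
  rw [map_sub, map_add] at h7
  simp only at h3
  rw [h3, zero_add] at h7
  simpa using h7

/-- First-order perturbation identity for the ground projection. -/
theorem proj_sub_proj (h₁ : IsGappedGroundState H₁ l₁ γ₁ φ₁ P₁ R₁)
    (h₂ : IsGappedGroundState H₂ l₂ γ₂ φ₂ P₂ R₂) {W : E →L[ℂ] E}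
    (hW : ∀ x : D, H₂ x - H₁ x = (l₂ : ℂ) • (x : E) - (l₁ : ℂ) • (x : E) + W x) :
    P₂ - P₁ = -(R₁ * W * P₂) - P₁ * W * R₂ := by
  rw [← h₁.proj_sub_proj_mul h₂ hW, ← h₁.proj_sub_mul_proj h₂ hW]; abel

/-- First-order perturbation identity for the reduced resolvent. -/
theorem resolvent_sub_resolvent (h₁ : IsGappedGroundState H₁ l₁ γ₁ φ₁ P₁ R₁)
    (h₂ : IsGappedGroundState H₂ l₂ γ₂ φ₂ P₂ R₂) {W : E →L[ℂ] E}
    (hW : ∀ x : D, H₂ x - H₁ x = (l₂ : ℂ) • (x : E) - (l₁ : ℂ) • (x : E) + W x) :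
    R₂ - R₁ = P₁ * W * (R₂ * R₂) + R₁ * R₁ * W * P₂ - R₁ * W * R₂ := by
  -- The same expansion of `1 - P₂`, now multiplied by `R₁`. The cross terms `P₁ R₂` and `R₁ P₂`
  -- also carry a factor `W`, by the projection identities.
  have h3 : R₂ - P₁ * R₂ + R₁ * W * R₂ = R₁ - R₁ * P₂ := by
    ext x
    have h3 := h₁.resolvent_sub ⟨R₂ x, h₂.resolvent_mem x⟩
    have h4 := hW ⟨R₂ x, h₂.resolvent_mem x⟩
    have h5 := h₂.sub_resolvent x
    have h6 : x - P₂ x = H₁ ⟨R₂ x, h₂.resolvent_mem x⟩ - (l₁ : ℂ) • R₂ x + W (R₂ x) := by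
      rw [← h5, ← sub_eq_zero]
      rw [← sub_eq_zero] at h4
      rw [← h4]; simp only; abel
    have h7 := congrArg R₁ h6
    rw [map_sub, map_add] at h7
    simp only at h3
    rw [h3] at h7
    simpa using h7.symm
  have h4 : P₁ * R₂ = P₁ * W * (R₂ * R₂) := by
    rw [← mul_assoc, ← h₁.proj_sub_mul_proj h₂ hW, sub_mul, mul_assoc P₁ P₂, h₂.proj_resolvent,
      mul_zero, sub_zero]
  have h5 : R₁ * P₂ = -(R₁ * R₁ * W * P₂) := by
    rw [mul_assoc R₁ R₁, mul_assoc R₁ (R₁ * W), ← mul_neg, ← h₁.proj_sub_proj_mul h₂ hW, mul_sub,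
      ← mul_assoc, h₁.resolvent_proj, zero_mul, sub_zero]
  rw [← h4, ← neg_neg (R₁ * R₁ * W * P₂), ← h5]
  rw [← sub_eq_zero] at h3 ⊢
  rw [← h3]; abel

/-- Variational principle, with `φ₁` as trial state for `H₂`. -/
theorem energy_sub_le (h₁ : IsGappedGroundState H₁ l₁ γ₁ φ₁ P₁ R₁)
    (h₂ : IsGappedGroundState H₂ l₂ γ₂ φ₂ P₂ R₂) {V : E →L[ℂ] E}
    (hV : ∀ x : D, H₂ x - H₁ x = V x) : l₂ - l₁ ≤ ‖V‖ := by
  have h3 := h₂.nonneg ⟨φ₁, h₁.state_mem⟩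
  have h4 : H₂ ⟨φ₁, h₁.state_mem⟩ = (l₁ : ℂ) • φ₁ + V φ₁ := by
    rw [← h₁.eigen, ← hV ⟨φ₁, h₁.state_mem⟩]; abel
  simp only at h3
  rw [h4, inner_add_right, inner_smul_right, h₁.inner_state_self, h₁.norm_state] at h3
  have h5 : (⟪φ₁, V φ₁⟫_ℂ).re ≤ ‖V‖ := by
    refine (Complex.re_le_norm _).trans ((norm_inner_le_norm _ _).trans ?_)
    have := V.le_opNorm φ₁
    rw [h₁.norm_state] at this ⊢
    linarith
  simp at h3
  linarith

theorem abs_energy_sub_le (h₁ : IsGappedGroundState H₁ l₁ γ₁ φ₁ P₁ R₁)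
    (h₂ : IsGappedGroundState H₂ l₂ γ₂ φ₂ P₂ R₂) {V : E →L[ℂ] E}
    (hV : ∀ x : D, H₂ x - H₁ x = V x) : |l₂ - l₁| ≤ ‖V‖ := by
  refine abs_sub_le_iff.2 ⟨h₁.energy_sub_le h₂ hV, ?_⟩
  have := h₂.energy_sub_le h₁ (V := -V) fun x => by simp [← hV]
  rwa [norm_neg] at this

/-- A finite-difference Hellmann–Feynman formula; using `P₂ φ₁` instead of `φ₂` makes it independent
of phases. -/
theorem energy_sub_mul (h₁ : IsGappedGroundState H₁ l₁ γ₁ φ₁ P₁ R₁)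
    (h₂ : IsGappedGroundState H₂ l₂ γ₂ φ₂ P₂ R₂) {V : E →L[ℂ] E}
    (hV : ∀ x : D, H₂ x - H₁ x = V x) :
    ((l₂ - l₁ : ℝ) : ℂ) * ⟪φ₁, P₂ φ₁⟫_ℂ = ⟪φ₁, V (P₂ φ₁)⟫_ℂ := by
  have h3 := h₁.symm ⟨φ₁, h₁.state_mem⟩ ⟨P₂ φ₁, h₂.proj_mem φ₁⟩
  have h4 := hV ⟨P₂ φ₁, h₂.proj_mem φ₁⟩
  rw [h₁.eigen, inner_smul_left] at h3
  rw [h₂.eigen_proj] at h4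
  simp only at h4 h3
  rw [← h4, inner_sub_right, inner_smul_right, ← h3]
  simp; ring

end IsGappedGroundState

/-! ### Reduction to a norm-differentiable bounded perturbation. -/

namespace IsTwiceDifferentiable

variable {E : Type*} [NormedAddCommGroup E] [InnerProductSpace ℂ E] [CompleteSpace E]
  {D : Submodule ℂ E} {H : ℝ → D →ₗ[ℂ] E} {H' H'' : ℝ → E →L[ℂ] E}

/-- A differentiable family of operators with bounded derivative is a bounded, norm
differentiable perturbation of any of its members. -/
theorem exists_bounded_perturbation (hH : IsTwiceDifferentiable H H' H'') :
    ∃ h : ℝ → E →L[ℂ] E, (∀ s ∈ Set.Icc (0 : ℝ) 1, HasDerivWithinAt h (H' s) (Set.Icc 0 1) s) ∧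
      ∀ r ∈ Set.Icc (0 : ℝ) 1, ∀ s ∈ Set.Icc (0 : ℝ) 1, ∀ x : D,
        H s x - H r x = (h s - h r) x := by
  have hc : ContinuousOn H' (Set.Icc 0 1) := fun s hs => (hH.hasDeriv₂ s hs).continuousWithinAt
  -- Extending `H'` by constants makes it continuous on all of `ℝ`, so its integral is
  -- differentiable at the endpoints too. That integral is the perturbation sought: it differs from
  -- `H` by a constant on each vector of `D`.
  set G := Set.IccExtend (zero_le_one' ℝ) ((Set.Icc (0 : ℝ) 1).domRestrict H') with hG
  have hGc : Continuous G := (continuousOn_iff_continuous_domRestrict.1 hc).Icc_extend'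
  have hGe : ∀ s ∈ Set.Icc (0 : ℝ) 1, G s = H' s := fun s hs => by
    rw [hG, Set.IccExtend_of_mem _ _ hs]; rfl
  have hd : ∀ s ∈ Set.Icc (0 : ℝ) 1,
      HasDerivWithinAt (fun s => ∫ t in (0 : ℝ)..s, G t) (H' s) (Set.Icc 0 1) s := fun s hs => by
    rw [← hGe s hs]
    exact (hGc.integral_hasStrictDerivAt 0 s).hasDerivAt.hasDerivWithinAt
  refine ⟨_, hd, ?_⟩
  have key : ∀ x : D, ∀ s ∈ Set.Icc (0 : ℝ) 1,
      H s x - (∫ t in (0 : ℝ)..s, G t) x = H 0 x - (∫ t in (0 : ℝ)..0, G t) x := by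
    intro x
    have h1 : ∀ s ∈ Set.Icc (0 : ℝ) 1, HasDerivWithinAt
        (fun s => H s x - (∫ t in (0 : ℝ)..s, G t) x) 0 (Set.Icc 0 1) s := by
      intro s hs
      have h2 := (((ContinuousLinearMap.apply ℂ E (x : E)).restrictScalars ℝ).hasFDerivAt
        (x := ∫ t in (0 : ℝ)..s, G t)).comp_hasDerivWithinAt s (hd s hs)
      have h3 := (hH.hasDeriv s hs x).sub h2
      convert! h3 using 1
      simp
    refine constant_of_has_deriv_right_zero (fun s hs => (h1 s hs).continuousWithinAt)
      fun s hs => ?_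
    exact (h1 s ⟨hs.1, hs.2.le⟩).mono_of_mem_nhdsWithin
      (Icc_mem_nhdsGE_of_mem hs)
  intro r hr s hs x
  have h1 := key x r hr
  have h2 := key x s hs
  rw [sub_apply]
  rw [← h1, sub_eq_sub_iff_sub_eq_sub] at h2
  exact h2

end IsTwiceDifferentiable

/-! ### Differentiability of the ground energy, projection and reduced resolvent. -/

section Path

variable {E : Type*} [NormedAddCommGroup E] [InnerProductSpace ℂ E]
  {D : Submodule ℂ E} {H : ℝ → D →ₗ[ℂ] E} {h H' P R : ℝ → E →L[ℂ] E} {l : ℝ → ℝ} {γ : ℝ}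
  {φ : ℝ → E} {S : Set ℝ} {r : ℝ}

theorem energy_hasDerivWithinAt_of_tendsto
    (hG : ∀ s ∈ S, IsGappedGroundState (H s) (l s) γ (φ s) (P s) (R s))
    (hh : ∀ r ∈ S, ∀ s ∈ S, ∀ x : D, H s x - H r x = (h s - h r) x)
    (hd : ∀ s ∈ S, HasDerivWithinAt h (H' s) S s) (hr : r ∈ S)
    (hP : Tendsto P (𝓝[S] r) (𝓝 (P r))) :
    HasDerivWithinAt l (⟪φ r, H' r (φ r)⟫_ℂ).re S r := by
  have h0 := hG r hr
  have h1 := hasDerivWithinAt_iff_tendsto_slope.1 (hd r hr)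
  have hle : 𝓝[S \ {r}] r ≤ 𝓝[S] r := nhdsWithin_mono _ Set.sdiff_subset
  have hPφ : Tendsto (fun s => P s (φ r)) (𝓝[S \ {r}] r) (𝓝 (φ r)) := by
    have := ((ContinuousLinearMap.apply ℂ E (φ r)).continuous.tendsto (P r)).comp (hP.mono_left hle)
    simpa [Function.comp_def, h0.proj_state] using this
  have h2 : Tendsto (fun s => ⟪φ r, P s (φ r)⟫_ℂ) (𝓝[S \ {r}] r) (𝓝 1) := by
    rw [← h0.inner_state_self]
    exact tendsto_const_nhds.inner hPφ
  have h3 : Tendsto (fun s => ⟪φ r, slope h r s (P s (φ r))⟫_ℂ) (𝓝[S \ {r}] r)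
      (𝓝 ⟪φ r, H' r (φ r)⟫_ℂ) := tendsto_const_nhds.inner
      (((isBoundedBilinearMap_apply (𝕜 := ℂ) (E := E) (F := E)).continuous.tendsto _).comp
        (h1.prodMk_nhds hPφ))
  have h4 := (h3.div h2 one_ne_zero).congr' (f₂ := fun s => ((slope l r s : ℝ) : ℂ)) (by
    filter_upwards [h2.eventually_ne one_ne_zero, self_mem_nhdsWithin] with s hs hsS
    have h5 := h0.energy_sub_mul (hG s hsS.1) (hh r hr s hsS.1)
    rw [Pi.div_apply, div_eq_iff hs, slope_def_module, slope_def_module,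
      smul_apply, inner_smul_right_eq_smul, ← h5]
    simp [mul_assoc])
  rw [div_one] at h4
  rw [hasDerivWithinAt_iff_tendsto_slope]
  simpa [Function.comp_def] using (Complex.continuous_re.tendsto _).comp h4

theorem energy_continuousWithinAt
    (hG : ∀ s ∈ S, IsGappedGroundState (H s) (l s) γ (φ s) (P s) (R s))
    (hh : ∀ r ∈ S, ∀ s ∈ S, ∀ x : D, H s x - H r x = (h s - h r) x)
    (hd : ∀ s ∈ S, HasDerivWithinAt h (H' s) S s) (hr : r ∈ S) :
    ContinuousWithinAt l S r := by
  rw [ContinuousWithinAt, tendsto_iff_norm_sub_tendsto_zero]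
  have h1 := tendsto_iff_norm_sub_tendsto_zero.1 (hd r hr).continuousWithinAt
  refine squeeze_zero' (Eventually.of_forall fun _ => norm_nonneg _) ?_ h1
  filter_upwards [self_mem_nhdsWithin] with s hs
  exact (hG r hr).abs_energy_sub_le (hG s hs) (hh r hr s hs)

variable {k : ℝ → E →L[ℂ] E} {k' : E →L[ℂ] E}

theorem shifted_sub_eq (hh : ∀ r ∈ S, ∀ s ∈ S, ∀ x : D, H s x - H r x = (h s - h r) x)
    (hk : ∀ s, k s = h s - (l s : ℂ) • 1) :
    ∀ r ∈ S, ∀ s ∈ S, ∀ x : D,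
      H s x - H r x = (l s : ℂ) • (x : E) - (l r : ℂ) • (x : E) + (k s - k r) x := by
  intro r hr s hs x
  rw [hh r hr s hs, hk, hk]
  simp only [sub_apply, smul_apply,
    one_apply_eq_self]
  abel

theorem proj_tendsto
    (hG : ∀ s ∈ S, IsGappedGroundState (H s) (l s) γ (φ s) (P s) (R s))
    (hk : ∀ r ∈ S, ∀ s ∈ S, ∀ x : D,
      H s x - H r x = (l s : ℂ) • (x : E) - (l r : ℂ) • (x : E) + (k s - k r) x)
    (hkc : ContinuousWithinAt k S r) (hr : r ∈ S) :
    Tendsto P (𝓝[S] r) (𝓝 (P r)) := by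
  rw [tendsto_iff_norm_sub_tendsto_zero]
  have h1 := tendsto_iff_norm_sub_tendsto_zero.1 hkc
  have h2 := h1.const_mul (γ⁻¹ + γ⁻¹)
  rw [mul_zero] at h2
  refine squeeze_zero' (Eventually.of_forall fun _ => norm_nonneg _) ?_ h2
  filter_upwards [self_mem_nhdsWithin] with s hs
  have h0 := hG r hr
  have h3 := hG s hs
  have hγ := (norm_nonneg _).trans h0.norm_resolvent
  rw [h0.proj_sub_proj h3 (hk r hr s hs)]
  calc _ ≤ ‖R r‖ * ‖k s - k r‖ * ‖P s‖ + ‖P r‖ * ‖k s - k r‖ * ‖R s‖ := by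
        refine (norm_sub_le _ _).trans ?_
        rw [norm_neg]
        exact add_le_add (norm_mul₃_le ..) (norm_mul₃_le ..)
    _ ≤ γ⁻¹ * ‖k s - k r‖ * 1 + 1 * ‖k s - k r‖ * γ⁻¹ := by
        gcongr
        exacts [h0.norm_resolvent, h3.norm_proj, h0.norm_proj, h3.norm_resolvent]
    _ = _ := by ring

theorem resolvent_tendsto
    (hG : ∀ s ∈ S, IsGappedGroundState (H s) (l s) γ (φ s) (P s) (R s))
    (hk : ∀ r ∈ S, ∀ s ∈ S, ∀ x : D,
      H s x - H r x = (l s : ℂ) • (x : E) - (l r : ℂ) • (x : E) + (k s - k r) x)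
    (hkc : ContinuousWithinAt k S r) (hr : r ∈ S) :
    Tendsto R (𝓝[S] r) (𝓝 (R r)) := by
  rw [tendsto_iff_norm_sub_tendsto_zero]
  have h1 := tendsto_iff_norm_sub_tendsto_zero.1 hkc
  have h2 := h1.const_mul (3 * (γ⁻¹ * γ⁻¹))
  rw [mul_zero] at h2
  refine squeeze_zero' (Eventually.of_forall fun _ => norm_nonneg _) ?_ h2
  filter_upwards [self_mem_nhdsWithin] with s hs
  have h0 := hG r hr
  have h3 := hG s hs
  have hγ := (norm_nonneg _).trans h0.norm_resolvent
  rw [h0.resolvent_sub_resolvent h3 (hk r hr s hs)]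
  calc _ ≤ ‖P r‖ * ‖k s - k r‖ * (‖R s‖ * ‖R s‖) + (‖R r‖ * ‖R r‖) * ‖k s - k r‖ * ‖P s‖ +
        ‖R r‖ * ‖k s - k r‖ * ‖R s‖ := by
        refine (norm_sub_le _ _).trans (add_le_add ((norm_add_le _ _).trans
          (add_le_add ((norm_mul₃_le ..).trans ?_) ((norm_mul₃_le ..).trans ?_)))
          (norm_mul₃_le ..))
        · gcongr; exact norm_mul_le _ _
        · gcongr; exact norm_mul_le _ _
    _ ≤ 1 * ‖k s - k r‖ * (γ⁻¹ * γ⁻¹) + (γ⁻¹ * γ⁻¹) * ‖k s - k r‖ * 1 +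
        γ⁻¹ * ‖k s - k r‖ * γ⁻¹ := by
        gcongr
        exacts [h0.norm_proj, h3.norm_resolvent, h3.norm_resolvent, h0.norm_resolvent,
          h0.norm_resolvent, h3.norm_proj, h0.norm_resolvent, h3.norm_resolvent]
    _ = _ := by ring

theorem proj_hasDerivWithinAt
    (hG : ∀ s ∈ S, IsGappedGroundState (H s) (l s) γ (φ s) (P s) (R s))
    (hk : ∀ r ∈ S, ∀ s ∈ S, ∀ x : D,
      H s x - H r x = (l s : ℂ) • (x : E) - (l r : ℂ) • (x : E) + (k s - k r) x)
    (hkd : HasDerivWithinAt k k' S r) (hr : r ∈ S) :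
    HasDerivWithinAt P (-(R r * k' * P r) - P r * k' * R r) S r := by
  have hle : 𝓝[S \ {r}] r ≤ 𝓝[S] r := nhdsWithin_mono _ Set.sdiff_subset
  have hP := (proj_tendsto hG hk hkd.continuousWithinAt hr).mono_left hle
  have hR := (resolvent_tendsto hG hk hkd.continuousWithinAt hr).mono_left hle
  rw [hasDerivWithinAt_iff_tendsto_slope] at hkd ⊢
  refine ((((tendsto_const_nhds (x := R r)).mul hkd).mul hP).neg.sub
    (((tendsto_const_nhds (x := P r)).mul hkd).mul hR)).congr' ?_
  filter_upwards [self_mem_nhdsWithin] with s hs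
  rw [slope_def_module, slope_def_module, (hG r hr).proj_sub_proj (hG s hs.1) (hk r hr s hs.1)]
  rw [mul_smul_comm, mul_smul_comm, smul_mul_assoc, smul_mul_assoc, ← smul_neg, ← smul_sub]

theorem resolvent_hasDerivWithinAt
    (hG : ∀ s ∈ S, IsGappedGroundState (H s) (l s) γ (φ s) (P s) (R s))
    (hk : ∀ r ∈ S, ∀ s ∈ S, ∀ x : D,
      H s x - H r x = (l s : ℂ) • (x : E) - (l r : ℂ) • (x : E) + (k s - k r) x)
    (hkd : HasDerivWithinAt k k' S r) (hr : r ∈ S) :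
    HasDerivWithinAt R (P r * k' * (R r * R r) + R r * R r * k' * P r - R r * k' * R r) S r := by
  have hle : 𝓝[S \ {r}] r ≤ 𝓝[S] r := nhdsWithin_mono _ Set.sdiff_subset
  have hP := (proj_tendsto hG hk hkd.continuousWithinAt hr).mono_left hle
  have hR := (resolvent_tendsto hG hk hkd.continuousWithinAt hr).mono_left hle
  rw [hasDerivWithinAt_iff_tendsto_slope] at hkd ⊢
  refine (((((tendsto_const_nhds (x := P r)).mul hkd).mul (hR.mul hR)).add
    (((tendsto_const_nhds (x := R r * R r)).mul hkd).mul hP)).sub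
    (((tendsto_const_nhds (x := R r)).mul hkd).mul hR)).congr' ?_
  filter_upwards [self_mem_nhdsWithin] with s hs
  rw [slope_def_module, slope_def_module,
    (hG r hr).resolvent_sub_resolvent (hG s hs.1) (hk r hr s hs.1)]
  rw [mul_smul_comm, mul_smul_comm, mul_smul_comm, smul_mul_assoc, smul_mul_assoc, smul_mul_assoc,
    ← smul_add, ← smul_sub]

end Path

section Path

variable {E : Type*} [NormedAddCommGroup E] [InnerProductSpace ℂ E]
  {D : Submodule ℂ E} {H : ℝ → D →ₗ[ℂ] E} {h H' H'' P R : ℝ → E →L[ℂ] E} {l : ℝ → ℝ} {γ : ℝ}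
  {φ : ℝ → E} {S : Set ℝ} {r : ℝ}

/-- The velocity of the Hamiltonian shifted by its ground energy. -/
noncomputable def shiftedVelocity (H' : ℝ → E →L[ℂ] E) (φ : ℝ → E) (r : ℝ) : E →L[ℂ] E :=
  H' r - (((⟪φ r, H' r (φ r)⟫_ℂ).re : ℝ) : ℂ) • 1

theorem norm_shiftedVelocity_le (hφ : ‖φ r‖ = 1) : ‖shiftedVelocity H' φ r‖ ≤ 2 * ‖H' r‖ := by
  have h1 : |(⟪φ r, H' r (φ r)⟫_ℂ).re| ≤ ‖H' r‖ := by
    refine (Complex.abs_re_le_norm _).trans ((norm_inner_le_norm _ _).trans ?_)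
    have := (H' r).le_opNorm (φ r)
    rw [hφ] at this ⊢
    linarith
  have h2 : ‖(1 : E →L[ℂ] E)‖ ≤ 1 := ContinuousLinearMap.norm_id_le
  refine (norm_sub_le _ _).trans ?_
  rw [norm_smul, Complex.norm_real, Real.norm_eq_abs]
  have h3 : |(⟪φ r, H' r (φ r)⟫_ℂ).re| * ‖(1 : E →L[ℂ] E)‖ ≤ ‖H' r‖ * 1 := by gcongr
  linarith

/-- Bootstrap: the variational bound makes `l` continuous, hence `P` is continuous, hence the
Hellmann–Feynman quotient converges and `l` is differentiable. -/
theorem shifted_hasDerivWithinAt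
    (hG : ∀ s ∈ S, IsGappedGroundState (H s) (l s) γ (φ s) (P s) (R s))
    (hh : ∀ r ∈ S, ∀ s ∈ S, ∀ x : D, H s x - H r x = (h s - h r) x)
    (hd : ∀ s ∈ S, HasDerivWithinAt h (H' s) S s) (hr : r ∈ S) :
    HasDerivWithinAt (fun s => h s - (l s : ℂ) • (1 : E →L[ℂ] E)) (shiftedVelocity H' φ r) S r := by
  have hlc := energy_continuousWithinAt hG hh hd hr
  have hkc : ContinuousWithinAt (fun s => h s - (l s : ℂ) • (1 : E →L[ℂ] E)) S r :=
    (hd r hr).continuousWithinAt.sub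
      ((Complex.continuous_ofReal.continuousAt.comp_continuousWithinAt hlc).smul
        continuousWithinAt_const)
  have hP := proj_tendsto hG (shifted_sub_eq hh fun _ => rfl) hkc hr
  have hl := (((ContinuousLinearMap.toSpanSingleton ℂ (1 : E →L[ℂ] E)).restrictScalars
    ℝ).hasFDerivAt (x := (l r : ℂ))).comp_hasDerivWithinAt r
    (energy_hasDerivWithinAt_of_tendsto hG hh hd hr hP).ofReal_comp
  convert! (hd r hr).sub hl using 1

variable [CompleteSpace E]

/-- Both `P'` and its adjoint are derivatives of the self-adjoint family `P`, and derivatives are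
unique here. -/
theorem proj_velocity_isSelfAdjoint {P' : E →L[ℂ] E}
    (hG : ∀ s ∈ S, IsGappedGroundState (H s) (l s) γ (φ s) (P s) (R s))
    (hP : HasDerivWithinAt P P' S r) (hS : UniqueDiffWithinAt ℝ S r) (hr : r ∈ S) :
    IsSelfAdjoint P' := by
  have h1 : ∀ s ∈ S, star (P s) = P s := fun s hs =>
    (ContinuousLinearMap.isSelfAdjoint_iff_isSymmetric.2 fun x y => (hG s hs).proj_symm x y)
  have h2 : HasDerivWithinAt P (star P') S r :=
    hP.star.congr (fun s hs => (h1 s hs).symm) (h1 r hr).symm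
  exact hS.eq_deriv _ h2 hP

end Path

/-! ### Expectation values and norm estimates. -/

section Expectation

variable {E : Type*} [NormedAddCommGroup E] [InnerProductSpace ℂ E] {u : ℝ → E} {u' v : E}
  {Z : ℝ → E →L[ℂ] E} {Z' : E →L[ℂ] E} {S : Set ℝ} {s τ e : ℝ}

theorem HasDerivWithinAt.operator_apply (hZ : HasDerivWithinAt Z Z' S s)
    (hu : HasDerivWithinAt u u' S s) :
    HasDerivWithinAt (fun t => Z t (u t)) (Z s u' + Z' (u s)) S s := by
  have h1 := ((isBoundedBilinearMap_apply (𝕜 := ℂ) (E := E) (F := E)).hasFDerivAt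
    (Z s, u s)).restrictScalars ℝ
  exact HasFDerivAt.comp_hasDerivWithinAt (f := fun t => (Z t, u t)) s h1 (hZ.prodMk hu)

/-- The derivative of an expectation value along a solution of the Schrödinger equation, in terms
of the Hamiltonian shifted by any real number `e`. -/
theorem HasDerivWithinAt.expectation (hZ : HasDerivWithinAt Z Z' S s)
    (hu : HasDerivWithinAt u ((-Complex.I * (τ : ℂ)) • v) S s) :
    HasDerivWithinAt (fun t => ⟪u t, Z t (u t)⟫_ℂ)
      (Complex.I * τ * (⟪v - (e : ℂ) • u s, Z s (u s)⟫_ℂ - ⟪u s, Z s (v - (e : ℂ) • u s)⟫_ℂ) +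
        ⟪u s, Z' (u s)⟫_ℂ) S s := by
  have h1 := hu.inner ℂ (hZ.operator_apply hu)
  convert! h1 using 1
  simp only [inner_sub_left, inner_sub_right, inner_smul_left, inner_smul_right, map_sub, map_smul,
    inner_add_right, map_mul, map_neg, Complex.conj_I, Complex.conj_ofReal]
  ring

end Expectation

section Bounds

variable {E : Type*} [NormedAddCommGroup E] [InnerProductSpace ℂ E] {P R K V W : E →L[ℂ] E}
  {c g g' : ℝ}

/-- This bounds the derivative of `R² H' P`. The derivative of `R` is at most `6 c² g` and that of
`P` at most `4 c g`, so `16 = 2 · 6 + 4`. -/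
theorem norm_coupling_velocity_le (hP : ‖P‖ ≤ 1) (hR : ‖R‖ ≤ c) (hK : ‖K‖ ≤ 2 * g)
    (hV : ‖V‖ ≤ g) (hW : ‖W‖ ≤ g') :
    ‖((P * K * (R * R) + R * R * K * P - R * K * R) * R +
        R * (P * K * (R * R) + R * R * K * P - R * K * R)) * (V * P) +
      R * R * (W * P + V * (-(R * K * P) - P * K * R))‖ ≤ c ^ 2 * g' + 16 * c ^ 3 * g ^ 2 := by
  have hc : 0 ≤ c := (norm_nonneg _).trans hR
  have hg : 0 ≤ g := (norm_nonneg _).trans hV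
  have hg' : 0 ≤ g' := (norm_nonneg _).trans hW
  have mul_le : ∀ {X Y : E →L[ℂ] E} {a b : ℝ}, ‖X‖ ≤ a → ‖Y‖ ≤ b → ‖X * Y‖ ≤ a * b :=
    fun {X Y a b} hX hY => (norm_mul_le _ _).trans
      (mul_le_mul hX hY (norm_nonneg _) ((norm_nonneg _).trans hX))
  have add_le : ∀ {X Y : E →L[ℂ] E} {a b : ℝ}, ‖X‖ ≤ a → ‖Y‖ ≤ b → ‖X + Y‖ ≤ a + b :=
    fun {X Y a b} hX hY => (norm_add_le _ _).trans (add_le_add hX hY)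
  have sub_le : ∀ {X Y : E →L[ℂ] E} {a b : ℝ}, ‖X‖ ≤ a → ‖Y‖ ≤ b → ‖X - Y‖ ≤ a + b :=
    fun {X Y a b} hX hY => (norm_sub_le _ _).trans (add_le_add hX hY)
  have neg_le : ∀ {X : E →L[ℂ] E} {a : ℝ}, ‖X‖ ≤ a → ‖-X‖ ≤ a := fun hX => by rwa [norm_neg]
  have h1 := sub_le (add_le (mul_le (mul_le hP hK) (mul_le hR hR))
    (mul_le (mul_le (mul_le hR hR) hK) hP)) (mul_le (mul_le hR hK) hR)
  have h2 := sub_le (neg_le (mul_le (mul_le hR hK) hP)) (mul_le (mul_le hP hK) hR)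
  refine (add_le (mul_le (add_le (mul_le h1 hR) (mul_le hR h1)) (mul_le hV hP))
    (mul_le (mul_le hR hR) (add_le (mul_le hW hP) (mul_le hV h2)))).trans (le_of_eq ?_)
  ring

end Bounds

section Norm

variable {E : Type*} [NormedAddCommGroup E] [InnerProductSpace ℂ E]
  {D : Submodule ℂ E} {H : ℝ → D →ₗ[ℂ] E} {P R : ℝ → E →L[ℂ] E} {l : ℝ → ℝ}
  {φ u : ℝ → E} {τ γ : ℝ}

/-- Conservation of the expectation of the identity, by symmetry of `H`. -/
theorem norm_evolution_eq_one
    (hG : ∀ s ∈ Set.Icc (0 : ℝ) 1, IsGappedGroundState (H s) (l s) γ (φ s) (P s) (R s))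
    (hu : ∀ s ∈ Set.Icc (0 : ℝ) 1, u s ∈ D) (hu0 : u 0 = φ 0)
    (hud : ∀ (s : ℝ) (hs : s ∈ Set.Icc (0 : ℝ) 1), HasDerivWithinAt u
      ((-Complex.I * (τ : ℂ)) • H s ⟨u s, hu s hs⟩) (Set.Icc 0 1) s) :
    ∀ s ∈ Set.Icc (0 : ℝ) 1, ‖u s‖ = 1 := by
  have h1 : ∀ s ∈ Set.Icc (0 : ℝ) 1,
      HasDerivWithinAt (fun t => ⟪u t, u t⟫_ℂ) 0 (Set.Icc 0 1) s := by
    intro s hs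
    have h2 := (hasDerivWithinAt_const s (Set.Icc (0 : ℝ) 1) (1 : E →L[ℂ] E)).expectation (e := 0)
      (hud s hs)
    have h3 := (hG s hs).symm ⟨u s, hu s hs⟩ ⟨u s, hu s hs⟩
    convert! h2 using 1
    simp only [one_apply_eq_self, Complex.ofReal_zero, zero_smul, sub_zero, zero_apply,
      inner_zero_right, add_zero]
    simp only at h3
    rw [h3, sub_self, mul_zero]
  have h2 := constant_of_has_deriv_right_zero (fun s hs => (h1 s hs).continuousWithinAt)
    fun s hs => (h1 s ⟨hs.1, hs.2.le⟩).mono_of_mem_nhdsWithin (Icc_mem_nhdsGE_of_mem hs)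
  intro s hs
  have h3 := h2 s hs
  have h0 : (0 : ℝ) ∈ Set.Icc (0 : ℝ) 1 := ⟨le_rfl, zero_le_one⟩
  rw [hu0, (hG 0 h0).inner_state_self] at h3
  have h4 := inner_self_eq_norm_sq (𝕜 := ℂ) (u s)
  rw [h3, RCLike.one_re] at h4
  exact (pow_eq_one_iff_of_nonneg (norm_nonneg _) two_ne_zero).1 h4.symm

end Norm

/-! ### The adiabatic estimate. -/

section Adiabatic

variable {E : Type*} [NormedAddCommGroup E] [InnerProductSpace ℂ E] [CompleteSpace E]
  {D : Submodule ℂ E} {H : ℝ → D →ₗ[ℂ] E} {h H' H'' P R : ℝ → E →L[ℂ] E} {l : ℝ → ℝ}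
  {φ u : ℝ → E} {S : Set ℝ} {τ γ g₁ g₂ s : ℝ}

/-- Along the Schrödinger evolution, the excited population corrected by a term of order `1 / τ`
varies at a rate of order `1 / τ` times the excited amplitude. -/
theorem exists_corrected_population_deriv (hτ : 0 < τ)
    (hG : ∀ s ∈ S, IsGappedGroundState (H s) (l s) γ (φ s) (P s) (R s))
    (hh : ∀ r ∈ S, ∀ s ∈ S, ∀ x : D, H s x - H r x = (h s - h r) x)
    (hd : ∀ s ∈ S, HasDerivWithinAt h (H' s) S s)
    (hd' : ∀ s ∈ S, HasDerivWithinAt H' (H'' s) S s)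
    (hg₁ : ∀ s ∈ S, ‖H' s‖ ≤ g₁) (hg₂ : ∀ s ∈ S, ‖H'' s‖ ≤ g₂)
    (hS : UniqueDiffOn ℝ S) (hu : ∀ s ∈ S, u s ∈ D) (hun : ∀ s ∈ S, ‖u s‖ = 1)
    (hud : ∀ (s : ℝ) (hs : s ∈ S),
      HasDerivWithinAt u ((-Complex.I * (τ : ℂ)) • H s ⟨u s, hu s hs⟩) S s) (hs : s ∈ S) :
    ∃ d, HasDerivWithinAt (fun t => -(⟪u t, P t (u t)⟫_ℂ).re -
        2 / τ * (⟪u t, (R t * R t * (H' t * P t)) (u t)⟫_ℂ).im) d S s ∧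
      |d| ≤ 2 / τ * (γ⁻¹ ^ 2 * g₂ + 16 * γ⁻¹ ^ 3 * g₁ ^ 2) * ‖u s - P s (u s)‖ := by
  have hGs := hG s hs
  have hk := shifted_sub_eq (l := l) hh fun _ => rfl
  have hkd := shifted_hasDerivWithinAt hG hh hd hs
  have hKn := (norm_shiftedVelocity_le (H' := H') hGs.norm_state).trans
    (mul_le_mul_of_nonneg_left (hg₁ s hs) zero_le_two)
  have hPd := proj_hasDerivWithinAt hG hk hkd hs
  have hRd := resolvent_hasDerivWithinAt hG hk hkd hs
  -- The scalar shift drops out because `R P = 0`.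
  have hRKP : R s * shiftedVelocity H' φ s * P s = R s * (H' s * P s) := by
    rw [shiftedVelocity, mul_sub, sub_mul, mul_smul_comm, mul_one, smul_mul_assoc,
      hGs.resolvent_proj, smul_zero, sub_zero, mul_assoc]
  have hP' := proj_velocity_isSelfAdjoint hG hPd (hS s hs) hs
  set K := shiftedVelocity H' φ s with hK
  set P' := -(R s * K * P s) - P s * K * R s with hP'def
  set R' := P s * K * (R s * R s) + R s * R s * K * P s - R s * K * R s with hR'def
  set B := R s * K * P s with hB
  have hRP := hGs.resolvent_proj
  have hPR := hGs.proj_resolvent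
  have hPP : P s * P s = P s := by ext x; exact hGs.proj_proj x
  have hPsa : IsSelfAdjoint (P s) :=
    ContinuousLinearMap.isSelfAdjoint_iff_isSymmetric.2 fun x y => hGs.proj_symm x y
  -- Reading `B` off `P'` yields `B* = P K R` from self-adjointness of `P'`, with no need to prove
  -- `K` symmetric.
  have hBP : B = -(P' * P s) := by
    rw [hP'def, sub_mul, neg_mul, mul_assoc _ (R s) (P s), hRP, mul_zero, sub_zero, neg_neg,
      hB, mul_assoc _ (P s), hPP]
  have hCB : star B = P s * K * R s := by
    rw [hBP, star_neg, star_mul, hP'.star_eq, hPsa.star_eq, hP'def, mul_sub, mul_neg, hB,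
      ← mul_assoc, ← mul_assoc, ← mul_assoc, ← mul_assoc, hPR, zero_mul, zero_mul, hPP]
    abel
  have hBadj : ∀ x y, ⟪x, (P s * K * R s) y⟫_ℂ = ⟪B x, y⟫_ℂ := fun x y => by
    rw [← hCB, ContinuousLinearMap.star_eq_adjoint, ContinuousLinearMap.adjoint_inner_right]
  have hAd := (hRd.mul hRd).mul ((hd' s hs).mul hPd)
  set A' := (R' * R s + R s * R') * (H' s * P s) + R s * R s * (H'' s * P s + H' s * P') with hA'
  have hA'n : ‖A'‖ ≤ γ⁻¹ ^ 2 * g₂ + 16 * γ⁻¹ ^ 3 * g₁ ^ 2 :=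
    norm_coupling_velocity_le hGs.norm_proj hGs.norm_resolvent hKn (hg₁ s hs) (hg₂ s hs)
  -- Since `P R = 0`, only the derivative of the leftmost `R` survives; the result is `B* R B`,
  -- which is symmetric.
  have hPA' : P s * A' = P s * K * R s * R s * B := by
    have h1 : P s * R' = P s * K * (R s * R s) := by
      rw [hR'def]
      simp only [mul_sub, mul_add, ← mul_assoc, hPR, zero_mul, add_zero, sub_zero, hPP]
    rw [hA', hRKP]
    simp only [mul_add, add_mul, ← mul_assoc, hPR, zero_mul, add_zero, h1]
  have hdA := hAd.expectation (e := l s) (hud s hs)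
  have hdP := hPd.expectation (e := l s) (hud s hs)
  set w := H s ⟨u s, hu s hs⟩ - (l s : ℂ) • u s with hw
  have hPw : P s w = 0 := hGs.proj_sub ⟨u s, hu s hs⟩
  have hRw : R s w = u s - P s (u s) := hGs.resolvent_sub ⟨u s, hu s hs⟩
  have e1 : ⟪w, P s (u s)⟫_ℂ = 0 := by rw [← hGs.proj_symm, hPw, inner_zero_left]
  have hA : R s * R s * (H' s * P s) = R s * B := by rw [hRKP, mul_assoc]
  have e2 : ⟪w, (R s * R s * (H' s * P s)) (u s)⟫_ℂ = ⟪u s, B (u s)⟫_ℂ := by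
    rw [hA, mul_apply_eq_comp, ← hGs.resolvent_symm, hRw, inner_sub_left,
      hGs.proj_symm, ← mul_apply_eq_comp (P s), hB, ← mul_assoc, ← mul_assoc, hPR,
      zero_mul, zero_mul]
    simp
  have e3 : (R s * R s * (H' s * P s)) w = 0 := by
    simp [hPw]
  have e4 : (⟪u s, P' (u s)⟫_ℂ).re = -(2 * (⟪u s, B (u s)⟫_ℂ).re) := by
    have h1 : ⟪u s, P' (u s)⟫_ℂ = -⟪u s, B (u s)⟫_ℂ - ⟪B (u s), u s⟫_ℂ := by
      rw [← hBadj, hP'def]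
      simp only [sub_apply, neg_apply, inner_sub_right, inner_neg_right]
    have h2 : (⟪B (u s), u s⟫_ℂ).re = (⟪u s, B (u s)⟫_ℂ).re := by
      rw [← inner_conj_symm, Complex.conj_re]
    rw [h1, Complex.sub_re, Complex.neg_re, h2]
    ring
  have e5 : (⟪P s (u s), A' (u s)⟫_ℂ).im = 0 := by
    have h1 : (P s * A') (u s) = (P s * K * R s) (R s (B (u s))) := by rw [hPA']; rfl
    rw [hGs.proj_symm, ← mul_apply_eq_comp, h1, hBadj]
    rw [← Complex.conj_eq_iff_im, inner_conj_symm, hGs.resolvent_symm]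
  have e6 : |(⟪u s, A' (u s)⟫_ℂ).im| ≤
      (γ⁻¹ ^ 2 * g₂ + 16 * γ⁻¹ ^ 3 * g₁ ^ 2) * ‖u s - P s (u s)‖ := by
    have h1 : (⟪u s, A' (u s)⟫_ℂ).im = (⟪u s - P s (u s), A' (u s)⟫_ℂ).im := by
      rw [inner_sub_left, Complex.sub_im, e5, sub_zero]
    rw [h1]
    refine (Complex.abs_im_le_norm _).trans ((norm_inner_le_norm _ _).trans ?_)
    rw [mul_comm]
    have h2 := A'.le_of_opNorm_le hA'n (u s)
    rw [hun s hs, mul_one] at h2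
    gcongr
  rw [e1, hPw, inner_zero_right, sub_zero, mul_zero, zero_add] at hdP
  have hdA2 : HasDerivWithinAt (fun t => ⟪u t, (R t * R t * (H' t * P t)) (u t)⟫_ℂ)
      (Complex.I * τ * ⟪u s, B (u s)⟫_ℂ + ⟪u s, A' (u s)⟫_ℂ) S s := by
    convert! hdA using 1
    simp only [Pi.mul_apply]
    rw [e2, e3, inner_zero_right, sub_zero]
  refine ⟨_, ((Complex.reCLM.hasFDerivAt.comp_hasDerivWithinAt s hdP).neg).sub
    ((Complex.imCLM.hasFDerivAt.comp_hasDerivWithinAt s hdA2).const_mul (2 / τ)), ?_⟩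
  -- The cancellation: `-Re ⟪u, P' u⟫ = 2 Re ⟪u, B u⟫`, and `2 / τ` times the imaginary part of `i τ
  -- ⟪u, B u⟫` is the same.
  have e7 : -Complex.reCLM ⟪u s, P' (u s)⟫_ℂ - 2 / τ * Complex.imCLM
      (Complex.I * τ * ⟪u s, B (u s)⟫_ℂ + ⟪u s, A' (u s)⟫_ℂ) =
      -(2 / τ * (⟪u s, A' (u s)⟫_ℂ).im) := by
    rw [Complex.reCLM_apply, Complex.imCLM_apply, e4]
    simp
    field_simp
    ring
  rw [e7, abs_neg, abs_mul, abs_of_pos (by positivity), mul_assoc]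
  gcongr

/-- The excited amplitude of the state evolving from the ground state is of order `1 / τ`. -/
theorem norm_excited_le (hτ : 0 < τ)
    (hG : ∀ s ∈ Set.Icc (0 : ℝ) 1, IsGappedGroundState (H s) (l s) γ (φ s) (P s) (R s))
    (hh : ∀ r ∈ Set.Icc (0 : ℝ) 1, ∀ s ∈ Set.Icc (0 : ℝ) 1, ∀ x : D,
      H s x - H r x = (h s - h r) x)
    (hd : ∀ s ∈ Set.Icc (0 : ℝ) 1, HasDerivWithinAt h (H' s) (Set.Icc 0 1) s)
    (hd' : ∀ s ∈ Set.Icc (0 : ℝ) 1, HasDerivWithinAt H' (H'' s) (Set.Icc 0 1) s)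
    (hg₁ : ∀ s ∈ Set.Icc (0 : ℝ) 1, ‖H' s‖ ≤ g₁) (hg₂ : ∀ s ∈ Set.Icc (0 : ℝ) 1, ‖H'' s‖ ≤ g₂)
    (hu : ∀ s ∈ Set.Icc (0 : ℝ) 1, u s ∈ D) (hu0 : u 0 = φ 0)
    (hud : ∀ (s : ℝ) (hs : s ∈ Set.Icc (0 : ℝ) 1), HasDerivWithinAt u
      ((-Complex.I * (τ : ℂ)) • H s ⟨u s, hu s hs⟩) (Set.Icc 0 1) s)
    (hs : s ∈ Set.Icc (0 : ℝ) 1) :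
    ‖u s - P s (u s)‖ ≤
      2 / τ * (γ⁻¹ ^ 2 * g₁ + s * (γ⁻¹ ^ 2 * g₂ + 16 * γ⁻¹ ^ 3 * g₁ ^ 2)) := by
  have h0 : (0 : ℝ) ∈ Set.Icc (0 : ℝ) 1 := ⟨le_rfl, zero_le_one⟩
  have hun := norm_evolution_eq_one hG hu hu0 hud
  have hsub : Set.Icc 0 s ⊆ Set.Icc (0 : ℝ) 1 := Set.Icc_subset_Icc_right hs.2
  have hk := shifted_sub_eq (l := l) hh fun _ => rfl
  have hqc : ContinuousOn (fun t => ‖u t - P t (u t)‖) (Set.Icc 0 s) := by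
    refine ContinuousOn.norm fun t ht => ?_
    have ht' := hsub ht
    refine ContinuousWithinAt.mono ?_ hsub
    have hPd := proj_hasDerivWithinAt hG hk (shifted_hasDerivWithinAt hG hh hd ht') ht'
    exact ((hud t ht').sub (hPd.operator_apply (hud t ht'))).continuousWithinAt
  obtain ⟨t, ht, hmax⟩ := isCompact_Icc.exists_isMaxOn ⟨0, ⟨le_rfl, hs.1⟩⟩ hqc
  have ht' := hsub ht
  set M := ‖u t - P t (u t)‖ with hM
  have hM0 : 0 ≤ M := norm_nonneg _
  set C := γ⁻¹ ^ 2 * g₂ + 16 * γ⁻¹ ^ 3 * g₁ ^ 2 with hC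
  have hγ : 0 ≤ γ⁻¹ := (norm_nonneg _).trans (hG 0 h0).norm_resolvent
  have hg₁0 : 0 ≤ g₁ := (norm_nonneg _).trans (hg₁ 0 h0)
  have hg₂0 : 0 ≤ g₂ := (norm_nonneg _).trans (hg₂ 0 h0)
  have hC0 : 0 ≤ C := by positivity
  set f : ℝ → ℝ := fun t => -(⟪u t, P t (u t)⟫_ℂ).re -
        2 / τ * (⟪u t, (R t * R t * (H' t * P t)) (u t)⟫_ℂ).im with hf
  choose! d hfd hdle using fun t ht => exists_corrected_population_deriv hτ hG hh hd hd' hg₁ hg₂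
    (uniqueDiffOn_Icc zero_lt_one) hu hun hud (s := t) ht
  -- The corrector maps into the excited subspace, whence the factor `‖u - P u‖`; in particular it
  -- vanishes at time `0`.
  have hA : ∀ r ∈ Set.Icc (0 : ℝ) 1, |(⟪u r, (R r * R r * (H' r * P r)) (u r)⟫_ℂ).im| ≤
      γ⁻¹ ^ 2 * g₁ * ‖u r - P r (u r)‖ := by
    intro r hr
    have hGr := hG r hr
    have h1 : ⟪u r, (R r * R r * (H' r * P r)) (u r)⟫_ℂ =
        ⟪u r - P r (u r), (R r * R r * (H' r * P r)) (u r)⟫_ℂ := by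
      have h2 : P r * (R r * R r * (H' r * P r)) = 0 := by
        simp only [← mul_assoc, hGr.proj_resolvent, zero_mul]
      rw [inner_sub_left, hGr.proj_symm, ← mul_apply_eq_comp (P r), h2, zero_apply,
        inner_zero_right, sub_zero]
    rw [h1]
    refine (Complex.abs_im_le_norm _).trans ((norm_inner_le_norm _ _).trans ?_)
    rw [mul_comm]
    gcongr
    refine (ContinuousLinearMap.le_opNorm _ _).trans ?_
    rw [hun r hr, mul_one]
    calc _ ≤ ‖R r‖ * ‖R r‖ * (‖H' r‖ * ‖P r‖) := by
          refine (norm_mul_le _ _).trans ?_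
          gcongr <;> exact norm_mul_le _ _
      _ ≤ γ⁻¹ * γ⁻¹ * (g₁ * 1) := by
          gcongr
          exacts [hGr.norm_resolvent, hGr.norm_resolvent, hg₁ r hr, hGr.norm_proj]
      _ = _ := by ring
  have hmv : |f t - f 0| ≤ 2 / τ * C * M * t := by
    have h1 := norm_image_sub_le_of_norm_deriv_le_segment' (f := f) (f' := d) (a := 0) (b := t)
      (C := 2 / τ * C * M)
      (fun r hr => (hfd r ⟨hr.1, hr.2.trans ht'.2⟩).mono (Set.Icc_subset_Icc_right ht'.2))
      (fun r hr => (hdle r ⟨hr.1, hr.2.le.trans ht'.2⟩).trans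
        (mul_le_mul_of_nonneg_left (hmax ⟨hr.1, hr.2.le.trans ht.2⟩) (by positivity)))
      t ⟨ht.1, le_rfl⟩
    simpa using h1
  have hP0 : P 0 (u 0) = u 0 := by rw [hu0, (hG 0 h0).proj_state]
  have hf0 : f 0 = -1 := by
    have h1 := hA 0 h0
    rw [hP0, sub_self, norm_zero, mul_zero] at h1
    have h2 := (hG 0 h0).inner_state_self
    rw [hf]
    simp only
    rw [abs_nonpos_iff.1 h1, hP0, hu0, h2]
    simp
  have hft : M ^ 2 = f t + 1 + 2 / τ * (⟪u t, (R t * R t * (H' t * P t)) (u t)⟫_ℂ).im := by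
    rw [hM, (hG t ht').norm_sub_proj_apply, hun t ht']
    simp only [hf]
    ring
  -- Boundary term at the maximizer plus accumulated drift, each linear in `M`.
  have hMM : M * M ≤ 2 / τ * (γ⁻¹ ^ 2 * g₁ + s * C) * M := by
    have h1 := (abs_le.1 hmv).2
    rw [hf0] at h1
    have h2 := mul_le_mul_of_nonneg_left ((abs_le.1 (hA t ht')).2) (by positivity : 0 ≤ 2 / τ)
    have h3 : 2 / τ * C * M * t ≤ 2 / τ * C * M * s :=
      mul_le_mul_of_nonneg_left ht.2 (by positivity)
    have h4 : M * M = M ^ 2 := by ring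
    rw [h4, hft]
    linarith
  have hMle : M ≤ 2 / τ * (γ⁻¹ ^ 2 * g₁ + s * C) := by
    rcases hM0.eq_or_lt with h1 | h1
    · rw [← h1]
      have := hs.1
      positivity
    · exact le_of_mul_le_mul_right hMM h1
  exact (hmax ⟨hs.1, le_rfl⟩ : _ ≤ M).trans hMle

end Adiabatic

/-! ### The adiabatic theorem. -/

theorem mainTheorem7 {E : Type*} [NormedAddCommGroup E] [InnerProductSpace ℂ E] [CompleteSpace E]
    {N : ℕ∞} (hN : 2 ≤ N)
    (D : ℝ → Submodule ℂ E) (H : (τ : ℝ) → ℝ → (D τ →ₗ[ℂ] E))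
    (H' H'' : ℝ → ℝ → E →L[ℂ] E)
    (ψ : ℝ → ℝ → HilbertBasis (LevelIndex N) ℂ E) (ev : ℝ → ℝ → LevelIndex N → ℝ)
    (U : ℝ → ℝ → E →L[ℂ] E) (g₁ g₂ : ℝ → ℝ) (γmin : ℝ)
    (hself : ∀ τ > 0, ∀ s ∈ Set.Icc (0 : ℝ) 1, IsHamiltonian (H τ s))
    (hdiff : ∀ τ > 0, IsTwiceDifferentiable (H τ) (H' τ) (H'' τ))
    (heigen : ∀ τ > 0, ∀ s ∈ Set.Icc (0 : ℝ) 1, IsOrderedEigenbasis (H τ s) (ψ τ s) (ev τ s))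
    (hU : ∀ τ > 0, IsEvolution τ (H τ) (U τ))
    (hg₁ : ∀ τ > 0, ∀ s ∈ Set.Icc (0 : ℝ) 1, ‖H' τ s‖ ≤ g₁ τ)
    (hg₂ : ∀ τ > 0, ∀ s ∈ Set.Icc (0 : ℝ) 1, ‖H'' τ s‖ ≤ g₂ τ)
    (hγpos : 0 < γmin)
    (hγ : ∀ τ > 0, ∀ s ∈ Set.Icc (0 : ℝ) 1, γmin ≤ energyGap hN (ev τ s)) :
    ∀ τ > 0, ∀ s ∈ Set.Icc (0 : ℝ) 1,
      ‖(1 - groundProj hN (ψ τ s)) * U τ s * groundProj hN (ψ τ 0)‖ ≤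
        8 / (τ * γmin ^ 2) * (2 * g₁ τ + s * g₂ τ + s * (16 * g₁ τ ^ 2 / γmin)) := by

  intro τ hτ
  choose! R hR using fun s hs =>
    (heigen τ hτ s hs).exists_gappedGroundState hN (hself τ hτ s hs) hγpos (hγ τ hτ s hs)
  obtain ⟨h, hd, hh⟩ := (hdiff τ hτ).exists_bounded_perturbation
  have h0 : (0 : ℝ) ∈ Set.Icc (0 : ℝ) 1 := ⟨le_rfl, zero_le_one⟩
  have hE := hU τ hτ
  have hφ := (hR 0 h0).state_mem
  intro s hs
  have key := norm_excited_le (u := fun t => U τ t (ψ τ 0 (groundIndex hN))) hτ hR hh hd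
    (hdiff τ hτ).hasDeriv₂ (hg₁ τ hτ) (hg₂ τ hτ) (fun t ht => hE.mem_domain t ht _ hφ)
    (by simp [hE.initial]) (fun t ht => hE.schrodinger t ht _ hφ) hs
  have hg₁0 : 0 ≤ g₁ τ := (norm_nonneg _).trans (hg₁ τ hτ 0 h0)
  have hg₂0 : 0 ≤ g₂ τ := (norm_nonneg _).trans (hg₂ τ hτ 0 h0)
  have hs0 := hs.1
  -- The argument gives constants `2` and `1` where `8` and `2` are claimed.
  have hrhs : 2 / τ * (γmin⁻¹ ^ 2 * g₁ τ + s * (γmin⁻¹ ^ 2 * g₂ τ + 16 * γmin⁻¹ ^ 3 * g₁ τ ^ 2)) ≤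
      8 / (τ * γmin ^ 2) * (2 * g₁ τ + s * g₂ τ + s * (16 * g₁ τ ^ 2 / γmin)) := by
    have h1 : 2 / τ * (γmin⁻¹ ^ 2 * g₁ τ +
        s * (γmin⁻¹ ^ 2 * g₂ τ + 16 * γmin⁻¹ ^ 3 * g₁ τ ^ 2)) =
        2 / (τ * γmin ^ 2) * (1 * g₁ τ + s * g₂ τ + s * (16 * g₁ τ ^ 2 / γmin)) := by
      field_simp
      ring
    rw [h1]
    gcongr <;> norm_num
  refine ContinuousLinearMap.opNorm_le_bound _ (by positivity) fun x => ?_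
  simp only [mul_apply_eq_comp, sub_apply, one_apply_eq_self]
  -- As `P 0` has rank one, the operator norm is governed by the single trajectory started at the
  -- ground state.
  rw [(hR 0 h0).proj_apply x, map_smul, map_smul, ← smul_sub, norm_smul, mul_comm]
  refine mul_le_mul (key.trans hrhs) ?_ (norm_nonneg _) (by positivity)
  simpa [(hR 0 h0).norm_state] using norm_inner_le_norm (𝕜 := ℂ) (ψ τ 0 (groundIndex hN)) x
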